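/- Let $\mathcal M$ be the set of Laurent monomials in commuting variables $Y_i(k)$, $i\in\{1,2\}$, $k\in\mathbb Z$, with Nakajima's crystal structure for $U_q(G_2)$ (Cartan matrix $a_{11}=a_{22}=2$, $a_{12}=-3$, $a_{21}=-1$; choice $c_{12}=1$, $c_{21}=0$): put $$A_1(k)=Y_1(k)Y_1(k+1)Y_2(k)^{-1},\qquad A_2(k)=Y_2(k)Y_2(k+1)Y_1(k+1)^{-3}.$$ For $M=\prod_{i,k}Y_i(k)^{y_i(k)}\in\mathcal M$ let $\varphi_i(M)=\max_{k\in\mathbb Z}\sum_{l\le k}y_i(l)\ (\ge 0)$. If $\varphi_i(M)=0$, put $\tilde f_iM=0$; if $\varphi_i(M)>0$, put $\tilde f_iM=A_i(n_f)^{-1}M$, where $n_f$ is the smallest $k$ with $\sum_{l\le k}y_i(l)=\varphi_i(M)$. The crystal graph on $\mathcal M$ has an arrow $M\to M'$ whenever $\tilde f_iM=M'$ for some $i\in\{1,2\}$; connected components are those of the underlying undirected graph. Let $I=\{1,2,3,0,\overline 3,\overline 2,\overline 1\}$ be ordered by $1\prec2\prec3\prec0\prec\overline3\prec\overline2\prec\overline1$,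 and let $\mathrm{dist}(a,b)$ be the absolute value of the difference of the positions of $a$ and $b$ in this list. For $k\in\mathbb Z$ define $$X_1(k)=Y_1(k),\quad X_2(k)=Y_1(k+1)^{-1}Y_2(k),\quad X_3(k)=Y_1(k+1)^2Y_2(k+1)^{-1},\quad X_0(k)=Y_1(k+1)Y_1(k+2)^{-1},$$ $$X_{\overline3}(k)=Y_1(k+2)^{-2}Y_2(k+1),\quad X_{\overline2}(k)=Y_1(k+2)Y_2(k+2)^{-1},\quad X_{\overline1}(k)=Y_1(k+3)^{-1}.$$ **Theorem.** Let $m,n\ge0$ be integers and $\lambda=m\Lambda_1+n\Lambda_2$. Then $Y_1(1)^mY_2(1)^n=X_1(1)^m(X_1(2)X_2(1))^n$, and the connected component $\mathcal M(\lambda)$ of $\mathcal M$ containing this monomial is exactly the set of monomials $$M=X_{a_1}(2)\cdots X_{a_n}(2)\,X_{b_1}(1)\cdots X_{b_{m+n}}(1)$$ with $a_j,b_j\in I$, $a_1\succeq\cdots\succeq a_n$ and $b_1\succeq\cdots\succeq b_{m+n}$, such that - (i) $0$ occurs at most once among $a_1,\dots,a_n$ and at most once among $b_1,\dots,b_{m+n}$;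 - (ii) for $j=1,\dots,n$: $a_j\prec b_j$, unless $a_j=b_j=0$; - (iii) for $j=1,\dots,n$: $\mathrm{dist}(a_j,b_j)\le2$ if $a_j\in\{1,0\}$, and $\mathrm{dist}(a_j,b_j)\le3$ otherwise; - (iv) for $j=2,\dots,n$: $\mathrm{dist}(a_j,b_{j-1})\ge3$ if $a_j\in\{2,3,0\}$, and $\mathrm{dist}(a_j,b_{j-1})\ge2$ if $a_j=\overline3$. -/

import Mathlib

namespace G2Monomial

/-- The two nodes `1`, `2` of the Dynkin diagram of type `G₂`
(Cartan matrix `a₁₁ = a₂₂ = 2`, `a₁₂ = -3`, `a₂₁ = -1`). -/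
inductive Node
  | one
  | two
  deriving DecidableEq

/-- The group of Laurent monomials in the commuting variables `Y_i(k)`, `i = 1, 2`, `k ∈ ℤ`.
A monomial is given by its exponents, and the group law is written multiplicatively. -/
abbrev Monomial : Type := Multiplicative (Node × ℤ →₀ ℤ)

/-- The variable `Y_i(k)`. -/
noncomputable def Y (i : Node) (k : ℤ) : Monomial :=
  Multiplicative.ofAdd (Finsupp.single (i, k) 1)

/-- The monomials `A_i(k)` for the choice `c₁₂ = 1`, `c₂₁ = 0`:
`A₁(k) = Y₁(k) Y₁(k+1) Y₂(k)⁻¹` and `A₂(k) = Y₂(k) Y₂(k+1) Y₁(k+1)⁻³`. -/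
noncomputable def A : Node → ℤ → Monomial
  | .one, k => Y .one k * Y .one (k + 1) * (Y .two k)⁻¹
  | .two, k => Y .two k * Y .two (k + 1) * (Y .one (k + 1) ^ 3)⁻¹

/-- The sum of the exponents in `M` of the variables `Y_i(l)` with `l ≤ k`. -/
noncomputable def partialSum (i : Node) (M : Monomial) (k : ℤ) : ℤ :=
  (Multiplicative.toAdd M).sum fun p y => if p.1 = i ∧ p.2 ≤ k then y else 0

/-- `φ_i(M)`, the maximum of `0` and of all the partial sums. -/
noncomputable def phi (i : Node) (M : Monomial) : ℤ :=
  sSup (insert 0 (Set.range (partialSum i M)))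

/-- `n_f`, the smallest `k` at which the partial sum equals `φ_i(M)`; meaningful if `φ_i(M) > 0`
(see `isLeast_nf`). -/
noncomputable def nf (i : Node) (M : Monomial) : ℤ :=
  sInf {k : ℤ | partialSum i M k = phi i M}

/-- The Kashiwara operator `f̃_i` on monomials; `none` stands for the symbol `0`. -/
noncomputable def kashiwaraF (i : Node) (M : Monomial) : Option Monomial :=
  if 0 < phi i M then some ((A i (nf i M))⁻¹ * M) else none

/-- The arrows of the crystal graph on monomials: `M ⟶ M'` if `f̃_i M = M'` for some `i`. -/
def Arrow (M M' : Monomial) : Prop :=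
  ∃ i : Node, kashiwaraF i M = some M'

/-- The connected component of the monomial `M` in the crystal graph. -/
def component (M : Monomial) : Set Monomial :=
  {M' | Relation.EqvGen Arrow M M'}

/-- The index set `{1, 2, 3, 0, 3̄, 2̄, 1̄}`. -/
inductive Letter
  | one
  | two
  | three
  | zero
  | bar3
  | bar2
  | bar1
  deriving DecidableEq

/-- The position of a letter in the order `1 ≺ 2 ≺ 3 ≺ 0 ≺ 3̄ ≺ 2̄ ≺ 1̄`. -/
def Letter.rank : Letter → ℕ
  | .one => 0
  | .two => 1
  | .three => 2
  | .zero => 3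
  | .bar3 => 4
  | .bar2 => 5
  | .bar1 => 6

theorem Letter.rank_injective : Function.Injective Letter.rank := by
  intro a b h
  cases a <;> cases b <;> first | rfl | (simp [Letter.rank] at h)

/-- The linear order `1 ≺ 2 ≺ 3 ≺ 0 ≺ 3̄ ≺ 2̄ ≺ 1̄`. -/
noncomputable instance : LinearOrder Letter :=
  LinearOrder.lift' Letter.rank Letter.rank_injective

/-- The function `dist` on letters, the difference of the positions; its values are listed
in `letterDist_table`. -/
def letterDist (a b : Letter) : ℕ := Nat.dist a.rank b.rank

/-- The values of `dist`: it is symmetric, vanishes on the diagonal, and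
`dist(i,j) = dist(j̄,ī) = j - i` for `i < j`, `dist(i,0) = dist(0,ī) = 4 - i`,
`dist(i,j̄) = 8 - (i + j)`, where `i, j ∈ {1, 2, 3}`. -/
theorem letterDist_table :
    (∀ a b, letterDist a b = letterDist b a) ∧ (∀ a, letterDist a a = 0) ∧
    (letterDist .one .two = 1 ∧ letterDist .one .three = 2 ∧ letterDist .two .three = 1) ∧
    (letterDist .bar2 .bar1 = 1 ∧ letterDist .bar3 .bar1 = 2 ∧ letterDist .bar3 .bar2 = 1) ∧
    (letterDist .one .zero = 3 ∧ letterDist .two .zero = 2 ∧ letterDist .three .zero = 1) ∧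
    (letterDist .zero .bar1 = 3 ∧ letterDist .zero .bar2 = 2 ∧ letterDist .zero .bar3 = 1) ∧
    (letterDist .one .bar1 = 6 ∧ letterDist .one .bar2 = 5 ∧ letterDist .one .bar3 = 4) ∧
    (letterDist .two .bar1 = 5 ∧ letterDist .two .bar2 = 4 ∧ letterDist .two .bar3 = 3) ∧
    (letterDist .three .bar1 = 4 ∧ letterDist .three .bar2 = 3 ∧
      letterDist .three .bar3 = 2) := by
  refine ⟨fun a b => Nat.dist_comm _ _, fun a => Nat.dist_self _, ?_⟩
  simp [letterDist, Letter.rank, Nat.dist]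

/-- The monomials `X_a(k)`. -/
noncomputable def X : Letter → ℤ → Monomial
  | .one, k => Y .one k
  | .two, k => (Y .one (k + 1))⁻¹ * Y .two k
  | .three, k => Y .one (k + 1) ^ 2 * (Y .two (k + 1))⁻¹
  | .zero, k => Y .one (k + 1) * (Y .one (k + 2))⁻¹
  | .bar3, k => (Y .one (k + 2) ^ 2)⁻¹ * Y .two (k + 1)
  | .bar2, k => Y .one (k + 2) * (Y .two (k + 2))⁻¹
  | .bar1, k => (Y .one (k + 3))⁻¹

/-- The conditions (i)-(iv) on the upper row `a_1, …, a_n` and the lower row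
`b_1, …, b_{m+n}`, indexed from `0`; `b (Fin.castAdd m j)` is the entry of the lower row with the
same index as `a j`. -/
structure Admissible {m n : ℕ} (a : Fin n → Letter) (b : Fin (n + m) → Letter) : Prop where
  /-- (i) for the upper row. -/
  zero_upper : ∀ j k, a j = .zero → a k = .zero → j = k
  /-- (i) for the lower row. -/
  zero_lower : ∀ j k, b j = .zero → b k = .zero → j = k
  /-- (ii) -/
  column : ∀ j : Fin n,
    a j < b (Fin.castAdd m j) ∨ (a j = .zero ∧ b (Fin.castAdd m j) = .zero)
  /-- (iii) for `a_j = 1, 0`. -/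
  dist_le_two : ∀ j : Fin n, a j = .one ∨ a j = .zero →
    letterDist (a j) (b (Fin.castAdd m j)) ≤ 2
  /-- (iii) for the other letters. -/
  dist_le_three : ∀ j : Fin n, ¬ (a j = .one ∨ a j = .zero) →
    letterDist (a j) (b (Fin.castAdd m j)) ≤ 3
  /-- (iv) for `a_j = 2, 3, 0`; here `k = j - 1`. -/
  three_le_dist : ∀ j k : Fin n, (j : ℕ) = k + 1 →
    a j = .two ∨ a j = .three ∨ a j = .zero →
    3 ≤ letterDist (a j) (b (Fin.castAdd m k))
  /-- (iv) for `a_j = 3̄`; here `k = j - 1`. -/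
  two_le_dist : ∀ j k : Fin n, (j : ℕ) = k + 1 → a j = .bar3 →
    2 ≤ letterDist (a j) (b (Fin.castAdd m k))

theorem bddAbove_partialSum (i : Node) (M : Monomial) :
    BddAbove (insert 0 (Set.range (partialSum i M))) := by
  refine BddAbove.insert 0 ⟨∑ p ∈ (Multiplicative.toAdd M).support, |Multiplicative.toAdd M p|, ?_⟩
  rintro _ ⟨k, rfl⟩
  refine Finset.sum_le_sum fun p _ => ?_
  dsimp only
  split_ifs
  · exact le_abs_self _
  · exact abs_nonneg _

theorem isGreatest_phi (i : Node) (M : Monomial) :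
    IsGreatest (insert 0 (Set.range (partialSum i M))) (phi i M) :=
  ⟨Int.csSup_mem ⟨0, Set.mem_insert _ _⟩ (bddAbove_partialSum i M),
    fun _ hx => le_csSup (bddAbove_partialSum i M) hx⟩

theorem isLeast_nf (i : Node) (M : Monomial) (h : 0 < phi i M) :
    IsLeast {k : ℤ | partialSum i M k = phi i M} (nf i M) := by
  have hne : {k : ℤ | partialSum i M k = phi i M}.Nonempty := by
    rcases (isGreatest_phi i M).1 with h0 | ⟨k, hk⟩
    · omega
    · exact ⟨k, hk⟩
  have hbdd : BddBelow {k : ℤ | partialSum i M k = phi i M} := by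
    obtain ⟨N, hN⟩ := ((Multiplicative.toAdd M).support.image Prod.snd).bddBelow
    refine ⟨N, fun k hk => ?_⟩
    by_contra hlt
    have h0 : partialSum i M k = 0 := by
      refine Finset.sum_eq_zero fun p hp => ?_
      have hp2 : N ≤ p.2 := hN (by simpa using ⟨p.1, by simpa using hp⟩)
      exact if_neg fun hc => hlt (hp2.trans hc.2)
    have hk' : partialSum i M k = phi i M := hk
    omega
  exact ⟨Int.csInf_mem hne hbdd, fun _ hx => csInf_le hbdd hx⟩

end G2Monomial

namespace G2Monomial

/-! Both sides are compared with the lattice points of one explicit polytope. Write a monomial as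
`Y₁(1)^m Y₂(1)^n` times powers of `A_i(k)⁻¹`, `k = 1, 2, 3`; the six exponents are its coordinates.

Component (`component_eq_polytopeMonomials`): an arrow changes one coordinate by one, and its place
is governed by partial sums that are affine in the coordinates. The polytope inequalities are stable
under lowering and raising. Wherever a type-`i` partial sum exceeds its final value, a raising
operator applies and decreases the coordinate sum; otherwise all coordinates are zero. So every
lattice point is connected to the top monomial.

Tableaux: each `X_a(k)` is `Y₁(k)` times a product of `A⁻¹`'s that grows with the rank of `a`. A
pair of rows is therefore recorded by the numbers `P_c`, `Q_c` of entries of rank at least `c`, and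
its coordinates are sums of these. Admissibility becomes a system of linear inequalities in `P_c`,
`Q_c` (`admissible_iff_countConditions`). Adding them up gives the polytope; conversely, splitting
each coordinate as evenly as possible gives an admissible pair
(`InPolytope.exists_countConditions`). -/

/-! ### Partial sums and Kashiwara operators -/

theorem partialSum_mul (i : Node) (M N : Monomial) (k : ℤ) :
    partialSum i (M * N) k = partialSum i M k + partialSum i N k := by
  unfold partialSum
  rw [toAdd_mul]
  exact Finsupp.sum_add_index' (by simp) (by intros; split_ifs <;> simp)

theorem partialSum_one (i : Node) (k : ℤ) : partialSum i 1 k = 0 := by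
  simp [partialSum]

/-- The partial sum of exponents as a group homomorphism. -/
noncomputable def partialSumHom (i : Node) (k : ℤ) : Monomial →* Multiplicative ℤ where
  toFun M := Multiplicative.ofAdd (partialSum i M k)
  map_one' := by simp [partialSum_one]
  map_mul' M N := by simp [partialSum_mul]

theorem partialSum_inv (i : Node) (M : Monomial) (k : ℤ) :
    partialSum i M⁻¹ k = -partialSum i M k :=
  congrArg Multiplicative.toAdd (map_inv (partialSumHom i k) M)

theorem partialSum_pow (i : Node) (M : Monomial) (e : ℕ) (k : ℤ) :
    partialSum i (M ^ e) k = e * partialSum i M k := by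
  have := congrArg Multiplicative.toAdd (map_pow (partialSumHom i k) M e)
  simpa [partialSumHom] using this

theorem partialSum_zpow (i : Node) (M : Monomial) (e : ℤ) (k : ℤ) :
    partialSum i (M ^ e) k = e * partialSum i M k := by
  have := congrArg Multiplicative.toAdd (map_zpow (partialSumHom i k) M e)
  simpa [partialSumHom] using this

theorem partialSum_Y (i j : Node) (k l : ℤ) :
    partialSum i (Y j k) l = if j = i ∧ k ≤ l then 1 else 0 := by
  simp [partialSum, Y, Finsupp.sum_single_index]

/-- Only the factors `Y_i(k) Y_i(k+1)` contribute. The jump to `1` and then `2` is what turns a last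
maximum at `k` into a first maximum at `k`. -/
theorem partialSum_A_self (i : Node) (k l : ℤ) :
    partialSum i (A i k) l = if l < k then 0 else if l = k then 1 else 2 := by
  cases i <;> simp only [A, partialSum_mul, partialSum_inv, partialSum_pow, partialSum_Y,
    reduceCtorEq, false_and, true_and, if_false] <;> split_ifs <;> omega

/-- `f̃_i M` is obtained at the first place `k` where the partial sums attain a positive maximum. -/
theorem kashiwaraF_eq_some_iff (i : Node) (M M' : Monomial) :
    kashiwaraF i M = some M' ↔ ∃ k, M' = (A i k)⁻¹ * M ∧ 0 < partialSum i M k ∧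
      (∀ l < k, partialSum i M l < partialSum i M k) ∧
      ∀ l, partialSum i M l ≤ partialSum i M k := by
  have hg := isGreatest_phi i M
  have hle : ∀ l, partialSum i M l ≤ phi i M := fun l =>
    hg.2 (Set.mem_insert_of_mem _ ⟨l, rfl⟩)
  unfold kashiwaraF
  constructor
  · intro h
    split_ifs at h with hpos
    obtain ⟨hnf, hmin⟩ := isLeast_nf i M hpos
    have hnf' : partialSum i M (nf i M) = phi i M := hnf
    refine ⟨nf i M, (Option.some.inj h).symm, by omega, fun l hl => ?_, fun l => by
      rw [hnf']; exact hle l⟩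
    refine lt_of_le_of_ne (by rw [hnf']; exact hle l) fun he => ?_
    have : nf i M ≤ l := hmin (he.trans hnf')
    omega
  · rintro ⟨k, rfl, hpos, hlt, hmax⟩
    have hphi : phi i M = partialSum i M k := by
      refine le_antisymm ?_ (hle k)
      rcases hg.1 with h0 | ⟨l, hl⟩
      · omega
      · rw [← hl]; exact hmax l
    have hpos' : 0 < phi i M := by omega
    obtain ⟨hnf, hmin⟩ := isLeast_nf i M hpos'
    have hnf' : partialSum i M (nf i M) = phi i M := hnf
    have hk : nf i M = k := by
      refine le_antisymm (hmin hphi.symm) (not_lt.1 fun h => ?_)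
      have := hlt _ h
      omega
    rw [if_pos hpos', hk]

/-- The inverse operator: `f̃_i M' = M` with `M' = A_i(k) M` if and only if `k` is the last place
where the partial sums of `M` attain their maximum. -/
theorem kashiwaraF_A_mul_eq_some_iff (i : Node) (M M' : Monomial) :
    kashiwaraF i M' = some M ↔ ∃ k, M' = A i k * M ∧ 0 ≤ partialSum i M k ∧
      (∀ l, partialSum i M l ≤ partialSum i M k) ∧
      ∀ l, k < l → partialSum i M l < partialSum i M k := by
  rw [kashiwaraF_eq_some_iff]
  refine exists_congr fun k => ?_
  rw [eq_inv_mul_iff_mul_eq, eq_comm]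
  refine and_congr_right fun h => ?_
  subst h
  simp only [partialSum_mul, partialSum_A_self]
  constructor
  · rintro ⟨h0, h1, h2⟩
    simp only [lt_irrefl, if_true, if_false] at h0 h1 h2
    -- Beyond `k` the sums of `M'` exceed those of `M` by `2`, but at `k` only by `1`, so a weak
    -- inequality for `M'` is strict for `M`.
    have h3 : ∀ l, k < l → partialSum i M l < partialSum i M k := fun l hl => by
      have := h2 l
      rw [if_neg (by omega), if_neg (by omega)] at this
      omega
    refine ⟨by omega, fun l => ?_, h3⟩
    rcases lt_trichotomy l k with hl | rfl | hl
    · have := h1 l hl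
      rw [if_pos hl] at this
      omega
    · exact le_rfl
    · exact (h3 l hl).le
  · rintro ⟨h0, h1, h2⟩
    simp only [lt_irrefl, if_true, if_false]
    refine ⟨by omega, fun l hl => ?_, fun l => ?_⟩
    · have := h1 l
      rw [if_pos hl]
      omega
    · have h1' := h1 l
      have h2' := h2 l
      split_ifs <;> omega

/-! ### Coordinates and the polytope -/

/-- The monomial `Y₁(1)^m Y₂(1)^n ∏ A₁(k)^{-x_k} A₂(k)^{-z_k}`, the product over `k = 1, 2, 3`. -/
noncomputable def lowered (m n : ℕ) (x₁ z₁ x₂ z₂ x₃ z₃ : ℤ) : Monomial :=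
  Y .one 1 ^ m * Y .two 1 ^ n * A .one 1 ^ (-x₁) * A .two 1 ^ (-z₁) * A .one 2 ^ (-x₂) *
    A .two 2 ^ (-z₂) * A .one 3 ^ (-x₃) * A .two 3 ^ (-z₃)

theorem partialSum_one_lowered (m n : ℕ) (x₁ z₁ x₂ z₂ x₃ z₃ l : ℤ) :
    partialSum .one (lowered m n x₁ z₁ x₂ z₂ x₃ z₃) l =
      if l ≤ 0 then 0 else if l = 1 then m - x₁ else if l = 2 then m - 2 * x₁ + 3 * z₁ - x₂ else
      if l = 3 then m - 2 * x₁ + 3 * z₁ - 2 * x₂ + 3 * z₂ - x₃ else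
      m - 2 * x₁ + 3 * z₁ - 2 * x₂ + 3 * z₂ - 2 * x₃ + 3 * z₃ := by
  simp only [lowered, partialSum_mul, partialSum_zpow, partialSum_pow, A, partialSum_inv,
    partialSum_Y, reduceCtorEq, false_and, true_and, if_false]
  have hl : l ≤ 0 ∨ l = 1 ∨ l = 2 ∨ l = 3 ∨ 4 ≤ l := by omega
  rcases hl with hl | rfl | rfl | rfl | hl
  · simp [hl, show ¬ 1 ≤ l by omega, show ¬ 2 ≤ l by omega, show ¬ 3 ≤ l by omega,
      show ¬ 4 ≤ l by omega]
  · norm_num; ring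
  · norm_num; ring
  · norm_num; ring
  · simp [hl, show 1 ≤ l by omega, show 2 ≤ l by omega, show 3 ≤ l by omega,
      show ¬ l ≤ 0 by omega, show l ≠ 1 by omega, show l ≠ 2 by omega, show l ≠ 3 by omega]
    ring

theorem partialSum_two_lowered (m n : ℕ) (x₁ z₁ x₂ z₂ x₃ z₃ l : ℤ) :
    partialSum .two (lowered m n x₁ z₁ x₂ z₂ x₃ z₃) l =
      if l ≤ 0 then 0 else if l = 1 then n + x₁ - z₁ else
      if l = 2 then n + x₁ - 2 * z₁ + x₂ - z₂ else
      if l = 3 then n + x₁ - 2 * z₁ + x₂ - 2 * z₂ + x₃ - z₃ else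
      n + x₁ - 2 * z₁ + x₂ - 2 * z₂ + x₃ - 2 * z₃ := by
  simp only [lowered, partialSum_mul, partialSum_zpow, partialSum_pow, A, partialSum_inv,
    partialSum_Y, reduceCtorEq, false_and, true_and, if_false]
  have hl : l ≤ 0 ∨ l = 1 ∨ l = 2 ∨ l = 3 ∨ 4 ≤ l := by omega
  rcases hl with hl | rfl | rfl | rfl | hl
  · simp [hl, show ¬ 1 ≤ l by omega, show ¬ 2 ≤ l by omega, show ¬ 3 ≤ l by omega,
      show ¬ 4 ≤ l by omega]
  · norm_num; ring
  · norm_num; ring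
  · norm_num; ring
  · simp [hl, show 1 ≤ l by omega, show 2 ≤ l by omega, show 3 ≤ l by omega,
      show ¬ l ≤ 0 by omega, show l ≠ 1 by omega, show l ≠ 2 by omega, show l ≠ 3 by omega]
    ring

/-- The polytope whose lattice points are the exponents of the monomials in the component. -/
structure InPolytope (m n : ℕ) (x₁ z₁ x₂ z₂ x₃ z₃ : ℤ) : Prop where
  x₁_nonneg : 0 ≤ x₁
  x₁_le : x₁ ≤ m
  z₁_le : z₁ ≤ n + x₁
  x₂_le : x₂ ≤ 3 * z₁
  -- Bounds of this kind give stability under raising: `x₁` drops only if `x₁ > 3 * z₁ - x₂`, and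
  -- then this bound yields `z₁ ≤ n + (x₁ - 1)`.
  x₂_le' : x₂ ≤ 2 * z₁ + n
  z₂_le : 3 * z₂ ≤ 2 * x₂
  z₂_le' : 2 * z₂ ≤ x₂ + n
  x₃_le : 2 * x₃ ≤ 3 * z₂
  x₃_le' : x₃ ≤ z₂ + n
  z₃_le : 3 * z₃ ≤ x₃
  z₃_nonneg : 0 ≤ z₃
  z₃_le' : z₃ ≤ n

/-- The monomials given by the lattice points of the polytope. -/
def polytopeMonomials (m n : ℕ) : Set Monomial :=
  {M | ∃ x₁ z₁ x₂ z₂ x₃ z₃, InPolytope m n x₁ z₁ x₂ z₂ x₃ z₃ ∧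
    M = lowered m n x₁ z₁ x₂ z₂ x₃ z₃}

section shift
variable (m n : ℕ) (x₁ z₁ x₂ z₂ x₃ z₃ e : ℤ)

theorem A_one_one_zpow_mul_lowered : A .one 1 ^ e * lowered m n x₁ z₁ x₂ z₂ x₃ z₃ =
    lowered m n (x₁ - e) z₁ x₂ z₂ x₃ z₃ := by
  rw [lowered, lowered, neg_sub, sub_eq_add_neg, zpow_add]
  simp only [mul_assoc, mul_left_comm, mul_comm]

theorem A_two_one_zpow_mul_lowered : A .two 1 ^ e * lowered m n x₁ z₁ x₂ z₂ x₃ z₃ =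
    lowered m n x₁ (z₁ - e) x₂ z₂ x₃ z₃ := by
  rw [lowered, lowered, neg_sub, sub_eq_add_neg, zpow_add]
  simp only [mul_assoc, mul_left_comm, mul_comm]

theorem A_one_two_zpow_mul_lowered : A .one 2 ^ e * lowered m n x₁ z₁ x₂ z₂ x₃ z₃ =
    lowered m n x₁ z₁ (x₂ - e) z₂ x₃ z₃ := by
  rw [lowered, lowered, neg_sub, sub_eq_add_neg, zpow_add]
  simp only [mul_assoc, mul_left_comm, mul_comm]

theorem A_two_two_zpow_mul_lowered : A .two 2 ^ e * lowered m n x₁ z₁ x₂ z₂ x₃ z₃ =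
    lowered m n x₁ z₁ x₂ (z₂ - e) x₃ z₃ := by
  rw [lowered, lowered, neg_sub, sub_eq_add_neg, zpow_add]
  simp only [mul_assoc, mul_left_comm, mul_comm]

theorem A_one_three_zpow_mul_lowered : A .one 3 ^ e * lowered m n x₁ z₁ x₂ z₂ x₃ z₃ =
    lowered m n x₁ z₁ x₂ z₂ (x₃ - e) z₃ := by
  rw [lowered, lowered, neg_sub, sub_eq_add_neg, zpow_add]
  simp only [mul_assoc, mul_left_comm, mul_comm]

theorem A_two_three_zpow_mul_lowered : A .two 3 ^ e * lowered m n x₁ z₁ x₂ z₂ x₃ z₃ =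
    lowered m n x₁ z₁ x₂ z₂ x₃ (z₃ - e) := by
  rw [lowered, lowered, neg_sub, sub_eq_add_neg, zpow_add]
  simp only [mul_assoc, mul_left_comm, mul_comm]

end shift

/-! ### Stability of the polytope under arrows -/

theorem arrow_mem_polytopeMonomials {m n : ℕ} {M M' : Monomial} (h : Arrow M M')
    (hM : M ∈ polytopeMonomials m n) : M' ∈ polytopeMonomials m n := by
  obtain ⟨x₁, z₁, x₂, z₂, x₃, z₃, hp, rfl⟩ := hM
  obtain ⟨i, hi⟩ := h
  obtain ⟨k, rfl, hpos, hlt, hmax⟩ := (kashiwaraF_eq_some_iff _ _ _).1 hi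
  rw [← zpow_neg_one]
  obtain ⟨_, _, _, _, _, _, _, _, _, _, _, _⟩ := hp
  -- Positivity at `k` and a strict rise from `k - 1` to `k` suffice; the global maximum is not
  -- needed.
  have h0 := hlt (k - 1) (by omega)
  cases i
  · simp only [partialSum_one_lowered] at hpos h0
    -- The sums vanish up to `0` and are constant from `4` on; a rise at `4` is excluded by `3 * z₃
    -- ≤ x₃`.
    have hk : k = 1 ∨ k = 2 ∨ k = 3 := by split_ifs at hpos h0 <;> omega
    rcases hk with rfl | rfl | rfl
    · refine ⟨_, _, _, _, _, _, ?_, A_one_one_zpow_mul_lowered _ _ _ _ _ _ _ _ _⟩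
      norm_num at h0
      constructor <;> omega
    · refine ⟨_, _, _, _, _, _, ?_, A_one_two_zpow_mul_lowered _ _ _ _ _ _ _ _ _⟩
      norm_num at h0
      constructor <;> omega
    · refine ⟨_, _, _, _, _, _, ?_, A_one_three_zpow_mul_lowered _ _ _ _ _ _ _ _ _⟩
      norm_num at h0
      constructor <;> omega
  · simp only [partialSum_two_lowered] at hpos h0
    have hk : k = 1 ∨ k = 2 ∨ k = 3 := by split_ifs at hpos h0 <;> omega
    rcases hk with rfl | rfl | rfl
    · refine ⟨_, _, _, _, _, _, ?_, A_two_one_zpow_mul_lowered _ _ _ _ _ _ _ _ _⟩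
      norm_num at h0
      constructor <;> omega
    · refine ⟨_, _, _, _, _, _, ?_, A_two_two_zpow_mul_lowered _ _ _ _ _ _ _ _ _⟩
      norm_num at h0
      constructor <;> omega
    · refine ⟨_, _, _, _, _, _, ?_, A_two_three_zpow_mul_lowered _ _ _ _ _ _ _ _ _⟩
      norm_num at h0
      constructor <;> omega

/-- The effect of the raising operators on a polytope monomial. -/
theorem A_mul_lowered_mem {m n : ℕ} {x₁ z₁ x₂ z₂ x₃ z₃ : ℤ}
    (hp : InPolytope m n x₁ z₁ x₂ z₂ x₃ z₃) {i : Node} {k : ℤ}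
    (hpos : 0 ≤ partialSum i (lowered m n x₁ z₁ x₂ z₂ x₃ z₃) k)
    (hlt : partialSum i (lowered m n x₁ z₁ x₂ z₂ x₃ z₃) (k + 1) <
      partialSum i (lowered m n x₁ z₁ x₂ z₂ x₃ z₃) k) :
    ∃ y₁ w₁ y₂ w₂ y₃ w₃, InPolytope m n y₁ w₁ y₂ w₂ y₃ w₃ ∧
      A i k * lowered m n x₁ z₁ x₂ z₂ x₃ z₃ = lowered m n y₁ w₁ y₂ w₂ y₃ w₃ ∧
      y₁ + w₁ + y₂ + w₂ + y₃ + w₃ < x₁ + z₁ + x₂ + z₂ + x₃ + z₃ := by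
  obtain ⟨_, _, _, _, _, _, _, _, _, _, _, _⟩ := hp
  rw [← zpow_one (A i k)]
  cases i
  · simp only [partialSum_one_lowered] at hpos hlt
    -- A drop from `0` to `1` is excluded by `x₁ ≤ m`, and in the other type by `z₁ ≤ n + x₁`.
    have hk : k = 1 ∨ k = 2 ∨ k = 3 := by split_ifs at hpos hlt <;> omega
    rcases hk with rfl | rfl | rfl
    · refine ⟨_, _, _, _, _, _, ?_, A_one_one_zpow_mul_lowered _ _ _ _ _ _ _ _ _, by omega⟩
      norm_num at hlt
      constructor <;> omega
    · refine ⟨_, _, _, _, _, _, ?_, A_one_two_zpow_mul_lowered _ _ _ _ _ _ _ _ _, by omega⟩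
      norm_num at hlt
      constructor <;> omega
    · refine ⟨_, _, _, _, _, _, ?_, A_one_three_zpow_mul_lowered _ _ _ _ _ _ _ _ _, by omega⟩
      norm_num at hlt
      constructor <;> omega
  · simp only [partialSum_two_lowered] at hpos hlt
    have hk : k = 1 ∨ k = 2 ∨ k = 3 := by split_ifs at hpos hlt <;> omega
    rcases hk with rfl | rfl | rfl
    · refine ⟨_, _, _, _, _, _, ?_, A_two_one_zpow_mul_lowered _ _ _ _ _ _ _ _ _, by omega⟩
      norm_num at hlt
      constructor <;> omega
    · refine ⟨_, _, _, _, _, _, ?_, A_two_two_zpow_mul_lowered _ _ _ _ _ _ _ _ _, by omega⟩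
      norm_num at hlt
      constructor <;> omega
    · refine ⟨_, _, _, _, _, _, ?_, A_two_three_zpow_mul_lowered _ _ _ _ _ _ _ _ _, by omega⟩
      norm_num at hlt
      constructor <;> omega

theorem mem_polytopeMonomials_of_arrow {m n : ℕ} {M M' : Monomial} (h : Arrow M' M)
    (hM : M ∈ polytopeMonomials m n) : M' ∈ polytopeMonomials m n := by
  obtain ⟨x₁, z₁, x₂, z₂, x₃, z₃, hp, rfl⟩ := hM
  obtain ⟨i, hi⟩ := h
  obtain ⟨k, rfl, hpos, -, hlt⟩ := (kashiwaraF_A_mul_eq_some_iff _ _ _).1 hi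
  obtain ⟨y₁, w₁, y₂, w₂, y₃, w₃, hy, he, -⟩ :=
    A_mul_lowered_mem hp hpos (hlt (k + 1) (by omega))
  exact ⟨y₁, w₁, y₂, w₂, y₃, w₃, hy, he⟩

/-! ### Connectedness of the polytope -/

/-- If the partial sums do not attain their maximum at the end, then a raising operator applies. -/
theorem exists_last_max {s : ℤ → ℤ} (h0 : ∀ l ≤ 0, s l = 0) (h4 : ∀ l, 4 ≤ l → s l = s 4)
    (h : ∃ l, s 4 < s l) :
    ∃ k, 0 ≤ s k ∧ (∀ l, s l ≤ s k) ∧ ∀ l, k < l → s l < s k := by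
  have hs : ∀ l, (l ≤ 0 ∧ s l = s 0) ∨ l = 1 ∨ l = 2 ∨ l = 3 ∨ (4 ≤ l ∧ s l = s 4) := by
    intro l
    rcases le_or_gt l 0 with hl | hl
    · exact Or.inl ⟨hl, by rw [h0 l hl, h0 0 le_rfl]⟩
    · rcases le_or_gt 4 l with hl' | hl'
      · exact Or.inr (Or.inr (Or.inr (Or.inr ⟨hl', h4 l hl'⟩)))
      · omega
  have h00 := h0 0 le_rfl
  have key : ∀ k, 0 ≤ k → k < 4 → s 0 ≤ s k → s 1 ≤ s k → s 2 ≤ s k → s 3 ≤ s k → s 4 < s k →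
      (k < 1 → s 1 < s k) → (k < 2 → s 2 < s k) → (k < 3 → s 3 < s k) →
      ∃ k, 0 ≤ s k ∧ (∀ l, s l ≤ s k) ∧ ∀ l, k < l → s l < s k := by
    intro k hk hk4 g0 g1 g2 g3 g4 e1 e2 e3
    refine ⟨k, by omega, fun l => ?_, fun l hl => ?_⟩
    · rcases hs l with ⟨_, h⟩ | rfl | rfl | rfl | ⟨_, h⟩ <;> omega
    · rcases hs l with ⟨_, h⟩ | rfl | rfl | rfl | ⟨_, h⟩ <;> omega
  have hlt : s 4 < s 0 ∨ s 4 < s 1 ∨ s 4 < s 2 ∨ s 4 < s 3 := by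
    obtain ⟨l, hl⟩ := h
    rcases hs l with ⟨_, h⟩ | rfl | rfl | rfl | ⟨_, h⟩ <;> omega
  by_contra hc
  have k0 : ¬ (s 1 < s 0 ∧ s 2 < s 0 ∧ s 3 < s 0 ∧ s 4 < s 0) := fun h => hc <|
    key 0 (by omega) (by omega) (by omega) (by omega) (by omega) (by omega) (by omega)
      (by omega) (by omega) (by omega)
  have k1 : ¬ (s 0 ≤ s 1 ∧ s 2 < s 1 ∧ s 3 < s 1 ∧ s 4 < s 1) := fun h => hc <|
    key 1 (by omega) (by omega) (by omega) (by omega) (by omega) (by omega) (by omega)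
      (by omega) (by omega) (by omega)
  have k2 : ¬ (s 0 ≤ s 2 ∧ s 1 ≤ s 2 ∧ s 3 < s 2 ∧ s 4 < s 2) := fun h => hc <|
    key 2 (by omega) (by omega) (by omega) (by omega) (by omega) (by omega) (by omega)
      (by omega) (by omega) (by omega)
  have k3 : ¬ (s 0 ≤ s 3 ∧ s 1 ≤ s 3 ∧ s 2 ≤ s 3 ∧ s 4 < s 3) := fun h => hc <|
    key 3 (by omega) (by omega) (by omega) (by omega) (by omega) (by omega) (by omega)
      (by omega) (by omega) (by omega)
  omega

theorem eqvGen_lowered {m n : ℕ} (N : ℕ) : ∀ {x₁ z₁ x₂ z₂ x₃ z₃ : ℤ},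
    InPolytope m n x₁ z₁ x₂ z₂ x₃ z₃ → x₁ + z₁ + x₂ + z₂ + x₃ + z₃ ≤ N →
    Relation.EqvGen Arrow (lowered m n 0 0 0 0 0 0) (lowered m n x₁ z₁ x₂ z₂ x₃ z₃) := by
  induction N with
  | zero =>
    intro x₁ z₁ x₂ z₂ x₃ z₃ hp hN
    obtain ⟨_, _, _, _, _, _, _, _, _, _, _, _⟩ := hp
    -- All coordinates are nonnegative, by the chain of bounds leading from `0 ≤ z₃` back to `z₁`.
    obtain ⟨rfl, rfl, rfl, rfl, rfl, rfl⟩ :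
        x₁ = 0 ∧ z₁ = 0 ∧ x₂ = 0 ∧ z₂ = 0 ∧ x₃ = 0 ∧ z₃ = 0 := by omega
    exact .refl _
  | succ N ih =>
    intro x₁ z₁ x₂ z₂ x₃ z₃ hp hN
    by_cases hex : ∃ i l, partialSum i (lowered m n x₁ z₁ x₂ z₂ x₃ z₃) 4 <
        partialSum i (lowered m n x₁ z₁ x₂ z₂ x₃ z₃) l
    · obtain ⟨i, hi⟩ := hex
      obtain ⟨k, hpos, hmax, hlt⟩ := exists_last_max
        (s := partialSum i (lowered m n x₁ z₁ x₂ z₂ x₃ z₃))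
        (fun l hl => by cases i <;> simp [partialSum_one_lowered, partialSum_two_lowered, hl])
        (fun l hl => by
          cases i <;> simp only [partialSum_one_lowered, partialSum_two_lowered] <;>
            split_ifs <;> omega) hi
      obtain ⟨y₁, w₁, y₂, w₂, y₃, w₃, hy, he, hs⟩ :=
        A_mul_lowered_mem hp hpos (hlt (k + 1) (by omega))
      refine (ih hy (by push_cast at hN; omega)).trans _ _ _ (.rel _ _ ⟨i, ?_⟩)
      exact (kashiwaraF_A_mul_eq_some_iff _ _ _).2 ⟨k, he.symm, hpos, hmax, hlt⟩
    · push Not at hex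
      have h1 := hex .one
      have h2 := hex .two
      simp only [partialSum_one_lowered, partialSum_two_lowered] at h1 h2
      have a0 := h1 0
      have a1 := h1 1
      have a2 := h1 2
      have a3 := h1 3
      have b0 := h2 0
      have b1 := h2 1
      have b2 := h2 2
      have b3 := h2 3
      norm_num at a0 a1 a2 a3 b0 b1 b2 b3
      obtain ⟨_, _, _, _, _, _, _, _, _, _, _, _⟩ := hp
      -- Comparing the final sums with those at `3`, `2`, `1` kills the coordinates backwards, in
      -- the order `z₃, x₃, z₂, x₂, z₁, x₁`.
      obtain ⟨rfl, rfl, rfl, rfl, rfl, rfl⟩ :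
          x₁ = 0 ∧ z₁ = 0 ∧ x₂ = 0 ∧ z₂ = 0 ∧ x₃ = 0 ∧ z₃ = 0 := by omega
      exact .refl _

theorem lowered_zero (m n : ℕ) : lowered m n 0 0 0 0 0 0 = Y .one 1 ^ m * Y .two 1 ^ n := by
  simp [lowered]

theorem component_eq_polytopeMonomials (m n : ℕ) :
    component (Y .one 1 ^ m * Y .two 1 ^ n) = polytopeMonomials m n := by
  rw [← lowered_zero]
  ext M
  constructor
  · intro h
    have key : ∀ M M', Relation.EqvGen Arrow M M' →
        (M ∈ polytopeMonomials m n ↔ M' ∈ polytopeMonomials m n) := by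
      intro M M' h
      induction h with
      | rel _ _ h => exact ⟨arrow_mem_polytopeMonomials h, mem_polytopeMonomials_of_arrow h⟩
      | refl => exact Iff.rfl
      | symm _ _ _ ih => exact ih.symm
      | trans _ _ _ _ _ ih₁ ih₂ => exact ih₁.trans ih₂
    exact (key _ _ h).1 ⟨0, 0, 0, 0, 0, 0, by constructor <;> omega, rfl⟩
  · rintro ⟨x₁, z₁, x₂, z₂, x₃, z₃, hp, rfl⟩
    exact eqvGen_lowered (x₁ + z₁ + x₂ + z₂ + x₃ + z₃).toNat hp (Int.self_le_toNat _)
-- Rows and their counts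
/-- The number of entries of a row whose rank is at least `c`. -/
def rowCount {N : ℕ} (a : Fin N → Letter) (c : ℕ) : ℕ :=
  (Finset.univ.filter fun j => c ≤ (a j).rank).card

theorem rowCount_le {N : ℕ} (a : Fin N → Letter) (c : ℕ) : rowCount a c ≤ N :=
  (Finset.card_filter_le _ _).trans_eq (by simp)

theorem rowCount_anti {N : ℕ} (a : Fin N → Letter) {c d : ℕ} (h : c ≤ d) :
    rowCount a d ≤ rowCount a c :=
  Finset.card_le_card fun _ hj => by simp at hj ⊢; omega

theorem card_filter_val_lt (N p : ℕ) :
    (Finset.univ.filter fun j : Fin N => (j : ℕ) < p).card = min p N := by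
  rcases le_total N p with h | h
  · rw [Finset.filter_true_of_mem fun j _ => j.2.trans_le h]
    simp [h]
  · rw [min_eq_left h, ← Fintype.card_fin p, ← Finset.card_univ]
    refine (Finset.card_bij (fun i _ => Fin.castLE h i) ?_ ?_ ?_).symm
    · intro i _; simp
    · intro i _ j _ hij; exact Fin.castLE_injective h hij
    · intro j hj; exact ⟨⟨j, by simpa using hj⟩, by simp, rfl⟩

theorem Letter.le_iff_rank (x y : Letter) : x ≤ y ↔ x.rank ≤ y.rank := Iff.rfl

theorem Letter.lt_iff_rank (x y : Letter) : x < y ↔ x.rank < y.rank := by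
  rw [lt_iff_not_ge, Letter.le_iff_rank, not_le]

/-- In a weakly decreasing row the entries of rank at least `c` form an initial segment. This turns
conditions on entries into inequalities between lengths. -/
theorem le_rank_iff_lt_rowCount {N : ℕ} {a : Fin N → Letter} (ha : Antitone a) (c : ℕ)
    (j : Fin N) : c ≤ (a j).rank ↔ (j : ℕ) < rowCount a c := by
  have hmono : ∀ i k : Fin N, i ≤ k → (a k).rank ≤ (a i).rank := fun i k h => ha h
  constructor
  · intro h
    have hsub : (Finset.univ.filter fun i : Fin N => (i : ℕ) < j + 1) ⊆
        Finset.univ.filter fun i => c ≤ (a i).rank := by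
      intro i hi
      simp only [Finset.mem_filter, Finset.mem_univ, true_and] at hi ⊢
      exact h.trans (hmono i j (by rw [Fin.le_def]; omega))
    have := Finset.card_le_card hsub
    rw [card_filter_val_lt] at this
    have := j.2
    unfold rowCount
    omega
  · intro h
    by_contra hc
    have hsub : (Finset.univ.filter fun i => c ≤ (a i).rank) ⊆
        Finset.univ.filter fun i : Fin N => (i : ℕ) < j := by
      intro i hi
      simp only [Finset.mem_filter, Finset.mem_univ, true_and] at hi ⊢
      by_contra hij
      exact hc (hi.trans (hmono j i (by rw [Fin.le_def]; omega)))
    have := Finset.card_le_card hsub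
    rw [card_filter_val_lt] at this
    unfold rowCount at h
    omega

/-- The letter of a given rank (and `1̄` for ranks larger than `6`). -/
def Letter.ofRank : ℕ → Letter
  | 0 => .one
  | 1 => .two
  | 2 => .three
  | 3 => .zero
  | 4 => .bar3
  | 5 => .bar2
  | _ => .bar1

theorem Letter.rank_ofRank {r : ℕ} (h : r ≤ 6) : (Letter.ofRank r).rank = r := by
  interval_cases r <;> rfl

theorem Letter.rank_le (x : Letter) : x.rank ≤ 6 := by cases x <;> simp [Letter.rank]

/-- An antitone row with prescribed counts. -/
theorem exists_row {N p₁ p₂ p₃ p₄ p₅ p₆ : ℕ} (h₁ : p₁ ≤ N) (h₂ : p₂ ≤ p₁) (h₃ : p₃ ≤ p₂)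
    (h₄ : p₄ ≤ p₃) (h₅ : p₅ ≤ p₄) (h₆ : p₆ ≤ p₅) :
    ∃ a : Fin N → Letter, Antitone a ∧ rowCount a 1 = p₁ ∧ rowCount a 2 = p₂ ∧
      rowCount a 3 = p₃ ∧ rowCount a 4 = p₄ ∧ rowCount a 5 = p₅ ∧ rowCount a 6 = p₆ := by
  let r : ℕ → ℕ := fun j => if j < p₆ then 6 else if j < p₅ then 5 else if j < p₄ then 4 else
    if j < p₃ then 3 else if j < p₂ then 2 else if j < p₁ then 1 else 0
  have hr : ∀ j, r j ≤ 6 := fun j => by dsimp only [r]; split_ifs <;> omega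
  have hcount : ∀ c p, p ≤ N → (∀ j, c ≤ r j ↔ j < p) →
      rowCount (fun j : Fin N => Letter.ofRank (r j)) c = p := by
    intro c p hp h
    simp only [rowCount, Letter.rank_ofRank (hr _), h, card_filter_val_lt]
    omega
  refine ⟨fun j => Letter.ofRank (r j), fun i j hij => ?_, hcount 1 p₁ ?_ ?_, hcount 2 p₂ ?_ ?_,
    hcount 3 p₃ ?_ ?_, hcount 4 p₄ ?_ ?_, hcount 5 p₅ ?_ ?_, hcount 6 p₆ ?_ ?_⟩
  · rw [Letter.le_iff_rank, Letter.rank_ofRank (hr _), Letter.rank_ofRank (hr _)]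
    have : (i : ℕ) ≤ j := hij
    dsimp only [r]
    split_ifs <;> omega
  all_goals first | omega | (intro j; dsimp only [r]; split_ifs <;> omega)

/-! ### Admissibility in terms of counts -/

/-- The conditions on the counts of the two rows that express admissibility. -/
structure CountConditions (m n P₁ P₂ P₃ P₄ P₅ P₆ Q₁ Q₂ Q₃ Q₄ Q₅ Q₆ : ℕ) : Prop where
  P₁_le : P₁ ≤ n
  P₂_le : P₂ ≤ P₁
  P₃_le : P₃ ≤ P₂
  P₄_le : P₄ ≤ P₃
  P₅_le : P₅ ≤ P₄
  P₆_eq : P₆ = 0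
  Q₁_le : Q₁ ≤ n + m
  Q₂_le : Q₂ ≤ Q₁
  Q₃_le : Q₃ ≤ Q₂
  Q₄_le : Q₄ ≤ Q₃
  Q₅_le : Q₅ ≤ Q₄
  Q₆_le : Q₆ ≤ Q₅
  zero_upper : P₃ ≤ P₄ + 1
  zero_lower : Q₃ ≤ Q₄ + 1
  -- `col_c` says that `c ≤ a_j` forces `c + 1 ≤ b_j` in ranks. The case `c = 3` is missing because
  -- a `0` may stand over a `0`.
  col₀ : n ≤ Q₁
  col₁ : P₁ ≤ Q₂
  col₂ : P₂ ≤ Q₃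
  col₄ : P₄ ≤ Q₅
  col₅ : P₅ ≤ Q₆
  -- Upper bounds on `b_j` given `a_j`, read contrapositively; the minimum restricts to the first
  -- `n` columns.
  dist₃ : min Q₃ n ≤ P₁
  dist₅ : min Q₅ n ≤ P₂
  dist₆ : min Q₆ n ≤ P₄
  -- `skew_c` says that `c ≤ a_j` forces `c + 3 ≤ b_{j-1}`; the shift of index gives the `+ 1`.
  skew₁ : P₁ ≤ Q₄ + 1
  skew₂ : P₂ ≤ Q₅ + 1
  skew₃ : P₃ ≤ Q₆ + 1

/-- Admissibility in terms of ranks. -/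
structure RankAdmissible {m n : ℕ} (a : Fin n → ℕ) (b : Fin (n + m) → ℕ) : Prop where
  zero_upper : ∀ j k, a j = 3 → a k = 3 → j = k
  zero_lower : ∀ j k, b j = 3 → b k = 3 → j = k
  column : ∀ j : Fin n, a j < b (Fin.castAdd m j) ∨ (a j = 3 ∧ b (Fin.castAdd m j) = 3)
  dist_le_two : ∀ j : Fin n, a j = 0 ∨ a j = 3 → b (Fin.castAdd m j) ≤ a j + 2
  -- The column condition gives `a_j ≤ b_j`, so the absolute value disappears; the letters `1`, `0`
  -- satisfy the stronger bound anyway.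
  dist_le_three : ∀ j : Fin n, b (Fin.castAdd m j) ≤ a j + 3
  three_le_dist : ∀ j k : Fin n, (j : ℕ) = k + 1 → a j = 1 ∨ a j = 2 ∨ a j = 3 →
    a j + 3 ≤ b (Fin.castAdd m k) ∨ b (Fin.castAdd m k) + 3 ≤ a j
  two_le_dist : ∀ j k : Fin n, (j : ℕ) = k + 1 → a j = 4 →
    a j + 2 ≤ b (Fin.castAdd m k) ∨ b (Fin.castAdd m k) + 2 ≤ a j

theorem admissible_iff_rankAdmissible {m n : ℕ} (a : Fin n → Letter) (b : Fin (n + m) → Letter) :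
    Admissible a b ↔ RankAdmissible (fun j => (a j).rank) (fun j => (b j).rank) := by
  have e1 : ∀ x : Letter, x = .one ↔ x.rank = 0 := by intro x; cases x <;> simp [Letter.rank]
  have e2 : ∀ x : Letter, x = .two ↔ x.rank = 1 := by intro x; cases x <;> simp [Letter.rank]
  have e3 : ∀ x : Letter, x = .three ↔ x.rank = 2 := by intro x; cases x <;> simp [Letter.rank]
  have e0 : ∀ x : Letter, x = .zero ↔ x.rank = 3 := by intro x; cases x <;> simp [Letter.rank]
  have e4 : ∀ x : Letter, x = .bar3 ↔ x.rank = 4 := by intro x; cases x <;> simp [Letter.rank]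
  constructor
  · rintro ⟨h1, h2, h3, h4, h5, h6, h7⟩
    simp only [e0, e1, e2, e3, e4, Letter.lt_iff_rank, letterDist, Nat.dist] at h1 h2 h3 h4 h5 h6 h7
    refine ⟨h1, h2, h3, fun j hj => ?_, fun j => ?_, fun j k hk hj => ?_, fun j k hk hj => ?_⟩
    · have := h4 j hj
      omega
    · have h4 := h4 j
      have h5 := h5 j
      omega
    · have := h6 j k hk hj
      omega
    · have := h7 j k hk hj
      omega
  · rintro ⟨h1, h2, h3, h4, h5, h6, h7⟩
    constructor <;> simp only [e0, e1, e2, e3, e4, Letter.lt_iff_rank, letterDist, Nat.dist]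
    · exact h1
    · exact h2
    · exact h3
    · intro j hj
      have h3 := h3 j
      have h4 := h4 j hj
      omega
    · intro j _
      have h3 := h3 j
      have h5 := h5 j
      omega
    · intro j k hk hj
      have := h6 j k hk hj
      omega
    · intro j k hk hj
      have := h7 j k hk hj
      omega

theorem rankAdmissible_iff_countConditions {m n : ℕ} {a : Fin n → ℕ} {b : Fin (n + m) → ℕ}
    {P Q : ℕ → ℕ} (ka : ∀ c j, c ≤ a j ↔ (j : ℕ) < P c) (kb : ∀ c j, c ≤ b j ↔ (j : ℕ) < Q c)
    (rb : ∀ j, b j ≤ 6) (hP : ∀ c, P (c + 1) ≤ P c) (hQ : ∀ c, Q (c + 1) ≤ Q c)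
    (hPn : P 1 ≤ n) (hQn : Q 1 ≤ n + m) :
    RankAdmissible a b ↔ CountConditions m n (P 1) (P 2) (P 3) (P 4) (P 5) (P 6)
      (Q 1) (Q 2) (Q 3) (Q 4) (Q 5) (Q 6) := by
  have p2 := hP 1
  have p3 := hP 2
  have p4 := hP 3
  have p5 := hP 4
  have p6 := hP 5
  have q2 := hQ 1
  have q3 := hQ 2
  have q4 := hQ 3
  have q5 := hQ 4
  have q6 := hQ 5
  norm_num only at p2 p3 p4 p5 p6 q2 q3 q4 q5 q6
  have ga : ∀ c j (hj : j < n), j < P c → c ≤ a ⟨j, hj⟩ := fun c j hj => (ka c ⟨j, hj⟩).2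
  have la : ∀ c j (hj : j < n), P c ≤ j → a ⟨j, hj⟩ < c := fun c j hj h => by
    rw [← not_le, ka]; simpa using h
  have gb : ∀ c j (hj : j < n), j < Q c → c ≤ b (Fin.castAdd m ⟨j, hj⟩) := fun c j hj h =>
    (kb c _).2 h
  have lb : ∀ c j (hj : j < n), Q c ≤ j → b (Fin.castAdd m ⟨j, hj⟩) < c := fun c j hj h => by
    rw [← not_le, kb]; simpa using h
  constructor
  · rintro ⟨h1, h2, h3, h4, h5, h6, h7⟩
    have hcol : ∀ c, 0 < c → c ≠ 4 → ∀ j (hj : j < n), c ≤ a ⟨j, hj⟩ + 1 →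
        c ≤ b (Fin.castAdd m ⟨j, hj⟩) := by
      intro c hc hc4 j hj h
      have := h3 ⟨j, hj⟩
      omega
    have c6 : P 6 = 0 := by
      by_contra hc
      have e1 := ga 6 0 (by omega) (by omega)
      have e2 := rb (Fin.castAdd m ⟨0, by omega⟩)
      have e3 := h3 ⟨0, by omega⟩
      omega
    have hle : ∀ c, c ≠ 3 → P c ≤ n → P c ≤ Q (c + 1) := by
      intro c hc3 hn
      by_contra hc
      have e1 := ga c (Q (c + 1)) (by omega) (by omega)
      have e2 := lb (c + 1) (Q (c + 1)) (by omega) le_rfl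
      have e3 := hcol (c + 1) (by omega) (by omega) (Q (c + 1)) (by omega) (by omega)
      omega
    -- At a violation, `a_j ≥ c` while `b_{j-1} < c + 3 ≤ 6`. Condition (iv) excludes ranks `1` to
    -- `4` for `a_j`; a larger rank forces `b_j ≥ 6`, hence `b_{j-1} ≥ 6`.
    have hskew : ∀ c, 1 ≤ c → c ≤ 3 → P c ≤ n → P c ≤ Q (c + 3) + 1 := by
      intro c hc1 hc3 hn
      by_contra hc
      have e1 := ga c (Q (c + 3) + 1) (by omega) (by omega)
      have e2 := lb (c + 3) (Q (c + 3)) (by omega) le_rfl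
      have e3 := lb (c + 3) (Q (c + 3) + 1) (by omega) (by omega)
      have e4 := h3 ⟨Q (c + 3) + 1, by omega⟩
      have e5 := h6 ⟨Q (c + 3) + 1, by omega⟩ ⟨Q (c + 3), by omega⟩ rfl
      have e6 := h7 ⟨Q (c + 3) + 1, by omega⟩ ⟨Q (c + 3), by omega⟩ rfl
      -- Monotonicity of the lower row is recovered from `kb`.
      have e7 : b (Fin.castAdd m ⟨Q (c + 3) + 1, by omega⟩) ≤
          b (Fin.castAdd m ⟨Q (c + 3), by omega⟩) := by
        have := (kb _ (Fin.castAdd m ⟨Q (c + 3) + 1, by omega⟩)).1 le_rfl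
        rw [kb]
        simp only [Fin.val_castAdd] at this ⊢
        omega
      omega
    refine ⟨hPn, p2, p3, p4, p5, c6, hQn, q2, q3, q4, q5, q6, ?_, ?_, ?_, ?_, ?_, ?_, ?_, ?_, ?_,
      ?_, ?_, ?_, ?_⟩
    · by_contra hc
      have e1 := ga 3 (P 4) (by omega) (by omega)
      have e2 := ga 3 (P 4 + 1) (by omega) (by omega)
      have e3 := la 4 (P 4) (by omega) (by omega)
      have e4 := la 4 (P 4 + 1) (by omega) (by omega)
      have := h1 ⟨P 4, by omega⟩ ⟨P 4 + 1, by omega⟩ (by omega) (by omega)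
      simp at this
    · by_contra hc
      have e1 := kb 3 ⟨Q 4, by omega⟩
      have e2 := kb 3 ⟨Q 4 + 1, by omega⟩
      have e3 := kb 4 ⟨Q 4, by omega⟩
      have e4 := kb 4 ⟨Q 4 + 1, by omega⟩
      dsimp only at e1 e2 e3 e4
      have := h2 ⟨Q 4, by omega⟩ ⟨Q 4 + 1, by omega⟩ (by omega) (by omega)
      simp at this
    · by_contra hc
      have e2 := lb 1 (Q 1) (by omega) le_rfl
      have e3 := h3 ⟨Q 1, by omega⟩
      omega
    · exact hle 1 (by omega) (by omega)
    · exact hle 2 (by omega) (by omega)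
    · exact hle 4 (by omega) (by omega)
    · exact hle 5 (by omega) (by omega)
    · by_contra hc
      have e1 := la 1 (P 1) (by omega) le_rfl
      have e2 := gb 3 (P 1) (by omega) (by omega)
      have e3 := h4 ⟨P 1, by omega⟩
      omega
    · by_contra hc
      have e1 := la 2 (P 2) (by omega) le_rfl
      have e2 := gb 5 (P 2) (by omega) (by omega)
      have e3 := h5 ⟨P 2, by omega⟩
      omega
    · by_contra hc
      have e1 := la 4 (P 4) (by omega) le_rfl
      have e2 := gb 6 (P 4) (by omega) (by omega)
      have e3 := h4 ⟨P 4, by omega⟩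
      have e4 := h5 ⟨P 4, by omega⟩
      omega
    · exact hskew 1 (by omega) (by omega) (by omega)
    · exact hskew 2 (by omega) (by omega) (by omega)
    · exact hskew 3 (by omega) (by omega) (by omega)
  · rintro ⟨-, -, -, -, -, c0, -, -, -, -, -, -, c1, c2, c3, c4, c5, c6, c7, c8, c9, c10, c11, c12,
      c13⟩
    have va : ∀ j : Fin n, (a j = 0 ∧ P 1 ≤ j) ∨ (a j = 1 ∧ P 2 ≤ j ∧ j < P 1) ∨
        (a j = 2 ∧ P 3 ≤ j ∧ j < P 2) ∨ (a j = 3 ∧ P 4 ≤ j ∧ j < P 3) ∨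
        (a j = 4 ∧ P 5 ≤ j ∧ j < P 4) ∨ (a j = 5 ∧ j < P 5) := by
      intro j
      have e1 := ka 1 j
      have e2 := ka 2 j
      have e3 := ka 3 j
      have e4 := ka 4 j
      have e5 := ka 5 j
      have e6 := ka 6 j
      have : a j < 6 := by omega
      generalize a j = x at *
      interval_cases x <;> omega
    constructor
    · intro j k hj hk
      have e1 := ka 3 j
      have e2 := ka 3 k
      have e3 := ka 4 j
      have e4 := ka 4 k
      apply Fin.ext
      omega
    · intro j k hj hk
      have e1 := kb 3 j
      have e2 := kb 3 k
      have e3 := kb 4 j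
      have e4 := kb 4 k
      apply Fin.ext
      omega
    · intro j
      have g := fun c => kb c (Fin.castAdd m j)
      simp only [Fin.val_castAdd] at g
      have hj := j.2
      rcases va j with h | h | h | h | h | h
      · have := g 1; omega
      · have := g 2; omega
      · have := g 3; omega
      · have := g 3; omega
      · have := g 5; omega
      · have := g 6; omega
    · intro j hj'
      have g := fun c => kb c (Fin.castAdd m j)
      simp only [Fin.val_castAdd] at g
      have hj := j.2
      rcases va j with h | h | h | h | h | h
      · have := g 3; omega
      · omega
      · omega
      · have := g 6; omega
      · omega
      · omega
    · intro j
      have g := fun c => kb c (Fin.castAdd m j)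
      simp only [Fin.val_castAdd] at g
      have hj := j.2
      have hr := rb (Fin.castAdd m j)
      rcases va j with h | h | h | h | h | h
      · have := g 3; omega
      · have := g 5; omega
      · have := g 6; omega
      · omega
      · omega
      · omega
    · intro j k hk hj'
      have g := fun c => kb c (Fin.castAdd m k)
      simp only [Fin.val_castAdd] at g
      rcases va j with h | h | h | h | h | h
      · omega
      · have := g 4; omega
      · have := g 5; omega
      · have := g 6; omega
      · omega
      · omega
    · intro j k hk hj'
      -- The case of `3̄` is contained in `skew₃`, since rank `4` gives `j < P 4 ≤ P 3 ≤ Q 6 + 1`.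
      have g := kb 6 (Fin.castAdd m k)
      have e := ka 4 j
      simp only [Fin.val_castAdd] at g
      omega

theorem admissible_iff_countConditions {m n : ℕ} {a : Fin n → Letter} {b : Fin (n + m) → Letter}
    (ha : Antitone a) (hb : Antitone b) :
    Admissible a b ↔ CountConditions m n (rowCount a 1) (rowCount a 2) (rowCount a 3)
      (rowCount a 4) (rowCount a 5) (rowCount a 6) (rowCount b 1) (rowCount b 2) (rowCount b 3)
      (rowCount b 4) (rowCount b 5) (rowCount b 6) := by
  rw [admissible_iff_rankAdmissible]
  exact rankAdmissible_iff_countConditions (le_rank_iff_lt_rowCount ha)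
    (le_rank_iff_lt_rowCount hb) (fun j => (b j).rank_le) (fun c => rowCount_anti a c.le_succ)
    (fun c => rowCount_anti b c.le_succ) (rowCount_le a 1) (rowCount_le b 1)

/-! ### Counts and lattice points -/

theorem CountConditions.inPolytope {m n P₁ P₂ P₃ P₄ P₅ P₆ Q₁ Q₂ Q₃ Q₄ Q₅ Q₆ : ℕ}
    (h : CountConditions m n P₁ P₂ P₃ P₄ P₅ P₆ Q₁ Q₂ Q₃ Q₄ Q₅ Q₆) :
    InPolytope m n (Q₁ - n) Q₂ (Q₃ + Q₄ + P₁) (Q₅ + P₂) (Q₆ + P₃ + P₄) P₅ := by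
  obtain ⟨_, _, _, _, _, _, _, _, _, _, _, _, _, _, _, _, _, _, _, _, _, _, _, _, _⟩ := h
  constructor <;> omega

/-- The coordinates `x₂`, `z₂`, `x₃` must be split into counts. The distance and skew conditions ask
that the parts differ by at most one until the upper row is full, so nearly equal parts are chosen.
-/
theorem InPolytope.exists_countConditions {m n : ℕ} {x₁ z₁ x₂ z₂ x₃ z₃ : ℤ}
    (h : InPolytope m n x₁ z₁ x₂ z₂ x₃ z₃) :
    ∃ P₁ P₂ P₃ P₄ P₅ Q₁ Q₂ Q₃ Q₄ Q₅ Q₆ : ℕ,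
      CountConditions m n P₁ P₂ P₃ P₄ P₅ 0 Q₁ Q₂ Q₃ Q₄ Q₅ Q₆ ∧ x₁ = Q₁ - n ∧ z₁ = Q₂ ∧
      x₂ = Q₃ + Q₄ + P₁ ∧ z₂ = Q₅ + P₂ ∧ x₃ = Q₆ + P₃ + P₄ ∧ z₃ = P₅ := by
  obtain ⟨h₁, h₂, h₃, h₄, h₅, h₆, h₇, h₈, h₉, h₁₀, h₁₁, h₁₂⟩ := h
  obtain ⟨x₁, rfl⟩ := Int.eq_ofNat_of_zero_le (show 0 ≤ x₁ by omega)
  obtain ⟨z₁, rfl⟩ := Int.eq_ofNat_of_zero_le (show 0 ≤ z₁ by omega)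
  obtain ⟨x₂, rfl⟩ := Int.eq_ofNat_of_zero_le (show 0 ≤ x₂ by omega)
  obtain ⟨z₂, rfl⟩ := Int.eq_ofNat_of_zero_le (show 0 ≤ z₂ by omega)
  obtain ⟨x₃, rfl⟩ := Int.eq_ofNat_of_zero_le (show 0 ≤ x₃ by omega)
  obtain ⟨z₃, rfl⟩ := Int.eq_ofNat_of_zero_le (show 0 ≤ z₃ by omega)
  -- Thirds, with the excess going first to `P₁`, then to `Q₃`; once `P₁` has reached `n`, the rest
  -- is halved.
  obtain ⟨P₁, Q₃, Q₄, hx₂⟩ : ∃ P₁ Q₃ Q₄ : ℕ, x₂ = Q₃ + Q₄ + P₁ ∧ Q₄ ≤ Q₃ ∧ Q₃ ≤ Q₄ + 1 ∧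
      P₁ ≤ n ∧ (x₂ ≤ 3 * n ∧ Q₃ ≤ P₁ ∧ P₁ ≤ Q₄ + 1 ∨ 3 * n < x₂ ∧ P₁ = n) := by
    by_cases hc : x₂ ≤ 3 * n
    · exact ⟨(x₂ + 2) / 3, (x₂ + 1) / 3, x₂ / 3, by omega⟩
    · exact ⟨n, (x₂ - n + 1) / 2, (x₂ - n) / 2, by omega⟩
  obtain ⟨P₂, Q₅, hz₂⟩ : ∃ P₂ Q₅ : ℕ, z₂ = Q₅ + P₂ ∧ P₂ ≤ n ∧
      (z₂ ≤ 2 * n ∧ Q₅ ≤ P₂ ∧ P₂ ≤ Q₅ + 1 ∨ 2 * n < z₂ ∧ P₂ = n) := by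
    by_cases hc : z₂ ≤ 2 * n
    · exact ⟨(z₂ + 1) / 2, z₂ / 2, by omega⟩
    · exact ⟨n, z₂ - n, by omega⟩
  -- Here two of the three parts belong to the upper row, so beyond `3 * n` only `Q₆` grows.
  obtain ⟨P₃, P₄, Q₆, hx₃⟩ : ∃ P₃ P₄ Q₆ : ℕ, x₃ = Q₆ + P₃ + P₄ ∧ P₄ ≤ P₃ ∧ P₃ ≤ P₄ + 1 ∧
      P₃ ≤ n ∧ (x₃ ≤ 3 * n ∧ Q₆ ≤ P₄ ∧ P₃ ≤ Q₆ + 1 ∨ 3 * n < x₃ ∧ P₄ = n) := by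
    by_cases hc : x₃ ≤ 3 * n
    · exact ⟨(x₃ + 2) / 3, (x₃ + 1) / 3, x₃ / 3, by omega⟩
    · exact ⟨n, n, x₃ - 2 * n, by omega⟩
  refine ⟨P₁, P₂, P₃, P₄, z₃, x₁ + n, z₁, Q₃, Q₄, Q₅, Q₆, ?_, by omega⟩
  constructor <;> omega

/-! ### Tableau monomials in coordinates -/

/-- Each step to the next letter contributes one `A⁻¹`. Both steps `3 → 0 → 3̄` contribute
`A₁(k+1)⁻¹`, whence the exponent with two terms. -/
theorem X_eq (a : Letter) (k : ℤ) :
    X a k = Y .one k * A .one k ^ (-(if 1 ≤ a.rank then 1 else 0 : ℤ)) *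
      A .two k ^ (-(if 2 ≤ a.rank then 1 else 0 : ℤ)) *
      A .one (k + 1) ^ (-((if 3 ≤ a.rank then 1 else 0) + (if 4 ≤ a.rank then 1 else 0) : ℤ)) *
      A .two (k + 1) ^ (-(if 5 ≤ a.rank then 1 else 0 : ℤ)) *
      A .one (k + 2) ^ (-(if 6 ≤ a.rank then 1 else 0 : ℤ)) := by
  have h2 : k + 1 + 1 = k + 2 := by ring
  have h3 : k + 2 + 1 = k + 3 := by ring
  apply Multiplicative.toAdd.injective
  cases a <;> simp [X, A, Letter.rank, h2, h3] <;> abel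

theorem sum_ite_le_rank {N : ℕ} (a : Fin N → Letter) (c : ℕ) :
    (∑ j, if c ≤ (a j).rank then 1 else 0 : ℤ) = rowCount a c := by
  simp [rowCount]

theorem prod_zpow_eq {G : Type*} [CommGroup G] {N : ℕ} (g : G) (f : Fin N → ℤ) :
    ∏ j, g ^ f j = g ^ ∑ j, f j :=
  (map_sum (zmultiplesHom (Additive G) (Additive.ofMul g)) f Finset.univ).symm

theorem prod_X {N : ℕ} (a : Fin N → Letter) (k : ℤ) :
    ∏ j, X (a j) k = Y .one k ^ N * A .one k ^ (-(rowCount a 1 : ℤ)) *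
      A .two k ^ (-(rowCount a 2 : ℤ)) *
      A .one (k + 1) ^ (-((rowCount a 3 : ℤ) + rowCount a 4)) *
      A .two (k + 1) ^ (-(rowCount a 5 : ℤ)) * A .one (k + 2) ^ (-(rowCount a 6 : ℤ)) := by
  simp only [X_eq, Finset.prod_mul_distrib, prod_zpow_eq, Finset.sum_neg_distrib,
    Finset.sum_add_distrib, sum_ite_le_rank, Finset.prod_const, Finset.card_univ, Fintype.card_fin]

theorem prod_X_mul_prod_X {m n : ℕ} (a : Fin n → Letter) (b : Fin (n + m) → Letter)
    (h : rowCount a 6 = 0) :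
    (∏ j, X (a j) 2) * ∏ j, X (b j) 1 =
      lowered m n (rowCount b 1 - n) (rowCount b 2) (rowCount b 3 + rowCount b 4 + rowCount a 1)
        (rowCount b 5 + rowCount a 2) (rowCount b 6 + rowCount a 3 + rowCount a 4)
        (rowCount a 5) := by
  -- Rewriting `Y₁(2)^n` brings in `A₁(1)^n`, the source of the `- n` in the first coordinate. The
  -- hypothesis `h` removes `A₁(4)`, which has no coordinate.
  have hY : Y .one 2 = A .one 1 * Y .two 1 * (Y .one 1)⁻¹ := by
    apply Multiplicative.toAdd.injective
    simp [A]
  rw [prod_X, prod_X, h, hY, lowered]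
  norm_num only
  apply Multiplicative.toAdd.injective
  simp only [toAdd_mul, toAdd_zpow, toAdd_pow, toAdd_inv]
  module

end G2Monomial

theorem mainTheorem1 (m n : ℕ) :
    G2Monomial.Y .one 1 ^ m * G2Monomial.Y .two 1 ^ n =
        G2Monomial.X .one 1 ^ m * (G2Monomial.X .one 2 * G2Monomial.X .two 1) ^ n ∧
      G2Monomial.component (G2Monomial.Y .one 1 ^ m * G2Monomial.Y .two 1 ^ n) =
        {M : G2Monomial.Monomial |
          ∃ (a : Fin n → G2Monomial.Letter) (b : Fin (n + m) → G2Monomial.Letter),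
            Antitone a ∧ Antitone b ∧ G2Monomial.Admissible a b ∧
            M = (∏ j, G2Monomial.X (a j) 2) * ∏ j, G2Monomial.X (b j) 1} := by
  constructor
  · simp [G2Monomial.X]
  rw [G2Monomial.component_eq_polytopeMonomials]
  ext M
  constructor
  · rintro ⟨x₁, z₁, x₂, z₂, x₃, z₃, hp, rfl⟩
    obtain ⟨P₁, P₂, P₃, P₄, P₅, Q₁, Q₂, Q₃, Q₄, Q₅, Q₆, hc, rfl, rfl, rfl, rfl, rfl, rfl⟩ :=
      hp.exists_countConditions
    obtain ⟨a, ha, rfl, rfl, rfl, rfl, rfl, ha₆⟩ := G2Monomial.exists_row hc.P₁_le hc.P₂_le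
      hc.P₃_le hc.P₄_le hc.P₅_le (Nat.zero_le P₅)
    obtain ⟨b, hb, rfl, rfl, rfl, rfl, rfl, rfl⟩ := G2Monomial.exists_row hc.Q₁_le hc.Q₂_le
      hc.Q₃_le hc.Q₄_le hc.Q₅_le hc.Q₆_le
    refine ⟨a, b, ha, hb, ?_, (G2Monomial.prod_X_mul_prod_X a b ha₆).symm⟩
    rw [G2Monomial.admissible_iff_countConditions ha hb, ha₆]
    exact hc
  · rintro ⟨a, b, ha, hb, hab, rfl⟩
    have hc := (G2Monomial.admissible_iff_countConditions ha hb).1 hab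
    exact ⟨_, _, _, _, _, _, hc.inPolytope, G2Monomial.prod_X_mul_prod_X a b hc.P₆_eq⟩
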